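/- Let $a\ge 3$ be an integer, let $\rho>1$ be a root of the polynomial $x^3+(a-1)x^2-ax-1$, and let $N$ denote the norm from $\mathbb{Q}(\rho)$ to $\mathbb{Q}$. Then every $\alpha\in\mathbb{Z}[\rho]$ satisfies $|N(\alpha)|\ge 2a-3$ or is associated in $\mathbb{Z}[\rho]$ to a rational integer (that is, $\alpha=n\varepsilon$ for some $n\in\mathbb{Z}$ and some unit $\varepsilon$ of $\mathbb{Z}[\rho]$). The bound is attained by $-1+\rho^2$: this element is not associated in $\mathbb{Z}[\rho]$ to any rational integer, and $|N(-1+\rho^2)|=2a-3$. -/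

import Mathlib

open scoped IntermediateField

/-- The order `ℤ[ρ]`, as a subring of the field `ℚ(ρ)`. -/
noncomputable abbrev rootOrder (ρ : ℝ) : Subalgebra ℤ ℚ⟮ρ⟯ :=
  Algebra.adjoin ℤ {IntermediateField.AdjoinSimple.gen ℚ ρ}

/-- The generator `ρ`, as an element of the order `ℤ[ρ]`. -/
noncomputable def rootInOrder (ρ : ℝ) : rootOrder ρ :=
  ⟨IntermediateField.AdjoinSimple.gen ℚ ρ, Algebra.self_mem_adjoin_singleton ℤ _⟩

/-! The factors of `ρ * (ρ - 1) * (ρ + a) = 1` are units, and `1`, `1 / (ρ - 1)`, `1 / ρ` is a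
`ℤ`-basis of the order. The conjugates of `ρ` are `ρ` itself, just above `1`, then `r₂`, just below
`0`, and `r₃` in `(-a, -a + 1)`.

Let `0 < |N(α)| ≤ 2a - 4 = M²`. Powers of `ρ + a` enlarge `α₁` and `α₂`; then `ρ - 1` shrinks `α₁`
and `ρ` shrinks `α₂`. So some associate satisfies `M ≤ |α₁| < M / (ρ - 1)` and `M ≤ |α₂| < M / |r₂|`
(`exists_associated_reduced`), whence `|α₃| ≤ 1`. As `1 / (ρ - 1)` and `1 / |r₂|` are at least `a`,
the coordinates `y`, `z` are of size about `M` at most, and `x` is close to `α₃` (`reduced_bounds`).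

If `a ≥ 21` and `x ≠ 0`, this forces `y = z = 0`. If `x = 0`, the norm is a binary cubic in `y`, `z`
that is small only on the lines `y = 0`, `z = 0`, `y = -z`, where `α` is an integer times a unit.
For `a ≤ 20` finitely many cases with `x ≠ 0` remain. -/

/-- The norm of `x + y / (ρ - 1) + z / ρ` as a polynomial in the coordinates. -/
def normForm {R : Type*} [CommRing R] (a x y z : R) : R :=
  x ^ 3 + x ^ 2 * ((a + 1) * y - a * z)
    - x * ((a + 2) * y ^ 2 + (a - 1) * z ^ 2 + (a ^ 2 + 3 * a + 1) * (y * z))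
    + y ^ 3 + (a + 3) * (y ^ 2 * z) + (a + 4) * (y * z ^ 2) + z ^ 3

/-- The element `x + y / (r - 1) + z / r`, for a root `r` of the cubic. -/
def evalAt {R : Type*} [CommRing R] (a : ℤ) (r : R) (x y z : ℤ) : R :=
  x + y * (r ^ 2 + a * r) + z * (r ^ 2 + (a - 1) * r - a)

theorem normForm_intCast {R : Type*} [CommRing R] (a x y z : ℤ) :
    ((normForm a x y z : ℤ) : R) = normForm (a : R) x y z := by
  simp [normForm]

theorem normForm_neg {R : Type*} [CommRing R] (a x y z : R) :
    normForm a (-x) (-y) (-z) = -normForm a x y z := by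
  simp only [normForm]; ring

theorem normForm_smul {R : Type*} [CommRing R] (a m x y z : R) :
    normForm a (m * x) (m * y) (m * z) = m ^ 3 * normForm a x y z := by
  simp only [normForm]; ring

/-! ### Small values of the norm form at integer points -/

/-- The coordinates are small and the first one vanishes. -/
theorem le_abs_normForm_zero_or {a y z : ℤ} (ha : 3 ≤ a) (hy : |y| ≤ a) (hz : |z| ≤ a) :
    2 * a - 3 ≤ |normForm a 0 y z| ∨ ∃ m : ℤ, m ∣ y ∧ m ∣ z ∧ |normForm a 0 y z| = |m| ^ 3 := by
  wlog hy0 : 0 ≤ y generalizing y z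
  · have h := this (y := -y) (z := -z) (by rwa [abs_neg]) (by rwa [abs_neg]) (by omega)
    have e : normForm a 0 (-y) (-z) = -normForm a 0 y z := by
      rw [← normForm_neg, neg_zero]
    simpa only [e, abs_neg, dvd_neg] using h
  rw [abs_le] at hy hz
  rcases hy0.eq_or_lt with rfl | hy0
  · exact Or.inr ⟨z, dvd_zero _, dvd_rfl, by rw [← abs_pow]; simp [normForm]⟩
  rcases lt_trichotomy z 0 with hz0 | rfl | hz0
  · obtain ⟨t, rfl⟩ : ∃ t, z = -t := ⟨-z, by ring⟩
    rcases lt_trichotomy y t with h | rfl | h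
    · left
      obtain ⟨e, rfl⟩ : ∃ e, t = y + e := ⟨t - y, by ring⟩
      have he : 1 ≤ e := by omega
      have hea : e ≤ a - 1 := by omega
      refine le_trans ?_ (le_abs_self _)
      have e1 : normForm a 0 y (-(y + e)) = y * (y + e) * (a * e + y + e) - e ^ 3 := by
        simp only [normForm]; ring
      rw [e1]
      have h1 : (1 + e) * (a * e + 1 + e) ≤ y * (y + e) * (a * e + y + e) := by
        have : 1 + e ≤ y * (y + e) := by nlinarith
        have h3 : 0 ≤ a * e := by positivity
        exact mul_le_mul this (by linarith) (by linarith) (by nlinarith)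
      nlinarith [mul_nonneg (sq_nonneg e) (sub_nonneg.2 hea), mul_nonneg (sub_nonneg.2 he) (by linarith : 0 ≤ a)]
    · refine Or.inr ⟨y, dvd_rfl, (dvd_neg).2 dvd_rfl, ?_⟩
      rw [← abs_pow]; congr 1; simp only [normForm]; ring
    -- The sharp case: `t = d = 1`, that is `(y, z) = (2, -1)`, gives exactly `2a - 3`. It is the
    -- element `(ρ + 1) / (ρ * (ρ - 1))`, an associate of `ρ ^ 2 - 1`.
    · left
      obtain ⟨d, rfl⟩ : ∃ d, y = t + d := ⟨y - t, by ring⟩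
      have hd : 1 ≤ d := by omega
      have ht : 1 ≤ t := by omega
      have hda : d ≤ a - 1 := by omega
      have hta : t ≤ a - 1 := by omega
      rw [← abs_neg]
      refine le_trans ?_ (le_abs_self _)
      have e1 : -normForm a 0 (t + d) (-t) = (t + d) * (t * (a * d - t)) - d ^ 3 := by
        simp only [normForm]; ring
      rw [e1]
      have h0 : a ≤ a * d := by nlinarith
      have h1 : a * d - 1 ≤ t * (a * d - t) := by
        nlinarith [mul_nonneg (sub_nonneg.2 ht) (by linarith : 0 ≤ a * d - 1 - t)]
      have h2 : (1 + d) * (a * d - 1) ≤ (t + d) * (t * (a * d - t)) :=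
        mul_le_mul (by linarith) h1 (by linarith) (by linarith)
      nlinarith [mul_nonneg (sq_nonneg d) (sub_nonneg.2 hda), mul_nonneg (sub_nonneg.2 hd) (by linarith : 0 ≤ a - 1)]
  · refine Or.inr ⟨y, dvd_rfl, dvd_zero _, ?_⟩
    rw [← abs_pow]; congr 1; simp only [normForm]; ring
  · left
    refine le_trans ?_ (le_abs_self _)
    have e1 : normForm a 0 y z = y ^ 3 + (a + 3) * (y * (y * z)) + (a + 4) * (y * z * z) + z ^ 3 := by
      simp only [normForm]; ring
    have h1 : 1 ≤ y * z := by nlinarith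
    have h2 : 1 ≤ y * (y * z) := by nlinarith
    have h3 : 1 ≤ y * z * z := by nlinarith
    rw [e1]
    nlinarith [pow_pos hy0 3, pow_pos hz0 3]

/-- The box contains every reduced element with `x > 0` for these `a`; a common divisor `m ≤ 2`
accounts for all exceptions. -/
theorem le_abs_normForm_or_of_le_nine :
    ∀ a ∈ Finset.Icc (3 : ℤ) 9, ∀ x ∈ Finset.Icc (1 : ℤ) 3, ∀ y ∈ Finset.Icc (-4 : ℤ) 4,
      ∀ z ∈ Finset.Icc (-4 : ℤ) 4, 2 * a - 3 ≤ |normForm a x y z| ∨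
        ∃ m ∈ Finset.Icc (1 : ℤ) 2, m ∣ x ∧ m ∣ y ∧ m ∣ z ∧ |normForm a x y z| = |m| ^ 3 := by
  decide +kernel

/-- In this range the bounds leave only `x = 1`, up to sign, so a common divisor of the coordinates
is a unit. -/
theorem le_abs_normForm_one_or_of_le_twenty :
    ∀ a ∈ Finset.Icc (10 : ℤ) 20, ∀ y ∈ Finset.Icc (-6 : ℤ) 6, ∀ z ∈ Finset.Icc (-6 : ℤ) 6,
      2 * a - 3 ≤ |normForm a 1 y z| ∨ |normForm a 1 y z| = 1 := by
  decide +kernel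

/-- The integral part of the argument: coordinates of a reduced element of small norm satisfy the
hypotheses. -/
theorem le_abs_normForm_or {a x y z W : ℤ} (ha : 3 ≤ a) (hy : |y| ≤ W) (hz : |z| ≤ W)
    (hW : 0 < W * (a * (a - 2)) - (a - 1) →
      (W * (a * (a - 2)) - (a - 1)) ^ 2 ≤ (a * (a - 1)) ^ 2 * (2 * a - 4))
    (hx : a * (a - 1) * |x| ≤ a * (a - 1) + (2 * a - 1) * W)
    (hlarge : 21 ≤ a → x = 0 ∨ (y = 0 ∧ z = 0)) :
    2 * a - 3 ≤ |normForm a x y z| ∨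
      ∃ m : ℤ, m ∣ x ∧ m ∣ y ∧ m ∣ z ∧ |normForm a x y z| = |m| ^ 3 := by
  wlog hx0 : 0 ≤ x generalizing x y z
  · have h := this (x := -x) (y := -y) (z := -z) (by rwa [abs_neg]) (by rwa [abs_neg])
      (by rwa [abs_neg]) (by simpa using hlarge) (by omega)
    simpa only [normForm_neg, abs_neg, dvd_neg] using h
  rw [abs_of_nonneg hx0] at hx
  have hW0 : 0 ≤ W := (abs_nonneg y).trans hy
  have hWa : W ≤ a := by
    by_contra! h
    have h1 : a + 1 ≤ W := h
    -- In terms of `b = a - 3 ≥ 0` the inequality to refute says that a polynomial with positive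
    -- coefficients is nonpositive.
    obtain ⟨b, rfl⟩ : ∃ b, a = b + 3 := ⟨a - 3, by ring⟩
    have hb : 0 ≤ b := by omega
    have hb2 := pow_nonneg hb 2
    have hb3 := pow_nonneg hb 3
    have h2 : (b + 4) * ((b + 3) * (b + 1)) ≤ W * ((b + 3) * (b + 3 - 2)) := by
      rw [show b + 3 - 2 = b + 1 by ring]
      exact mul_le_mul_of_nonneg_right (by omega) (by positivity)
    have h3 : 0 ≤ (b + 4) * ((b + 3) * (b + 1)) - (b + 2) := by ring_nf; linarith
    have h4 := hW (by ring_nf at h2 ⊢; linarith)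
    have h5 : ((b + 4) * ((b + 3) * (b + 1)) - (b + 2)) ^ 2 ≤
        (W * ((b + 3) * (b + 3 - 2)) - (b + 3 - 1)) ^ 2 :=
      pow_le_pow_left₀ h3 (by linarith) 2
    have h6 := h5.trans h4
    ring_nf at h6
    linarith [pow_nonneg hb 4, pow_nonneg hb 5, pow_nonneg hb 6]
  rcases hx0.eq_or_lt with rfl | hx0
  · rcases le_abs_normForm_zero_or ha (hy.trans hWa) (hz.trans hWa) with h | ⟨m, h1, h2, h3⟩
    · exact Or.inl h
    · exact Or.inr ⟨m, dvd_zero _, h1, h2, h3⟩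
  by_cases hyz : y = 0 ∧ z = 0
  · obtain ⟨rfl, rfl⟩ := hyz
    exact Or.inr ⟨x, dvd_rfl, dvd_zero _, dvd_zero _, by rw [← abs_pow]; simp [normForm]⟩
  have ha20 : a ≤ 20 := by
    by_contra! h
    rcases hlarge h with h | h
    · omega
    · exact hyz h
  rw [abs_le] at hy hz
  by_cases ha9 : a ≤ 9
  · have key : W ≤ 4 ∧ x ≤ 3 := by
      clear hlarge hyz
      have : W ≤ 9 := by omega
      clear hy hz
      interval_cases a <;> interval_cases W <;> revert hW hx <;> norm_num <;> omega
    rcases le_abs_normForm_or_of_le_nine a (by simp; omega) x (by simp; omega) y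
      (by simp; omega) z (by simp; omega) with h | ⟨m, -, h⟩
    · exact Or.inl h
    · exact Or.inr ⟨m, h⟩
  · have key : W ≤ 6 ∧ x = 1 := by
      clear hlarge hyz hy hz
      have h10 : 10 ≤ a := by omega
      interval_cases a <;> interval_cases W <;> revert hW hx <;> norm_num <;> omega
    obtain ⟨hW6, rfl⟩ := key
    rcases le_abs_normForm_one_or_of_le_twenty a (by simp; omega) y
      (by simp; omega) z (by simp; omega) with h | h
    · exact Or.inl h
    · exact Or.inr ⟨1, one_dvd _, one_dvd _, one_dvd _, by simpa using h⟩

/-! ### From bounds on conjugates to bounds on coordinates -/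

/-- Bounds for the coordinates of `x + y u + z v` in terms of three conjugates. -/
theorem coordinate_bounds {a u₁ u₂ s v₁ q t x y z α₁ α₂ α₃ c : ℝ} (ha : 3 ≤ a)
    (hc : c * (a - 1) = 1) (hu₁ : 0 < u₁) (hv₁ : 0 < v₁) (hv₁' : v₁ < 1)
    (hu₂ : 0 < u₂) (hu₂' : u₂ < 1) (hs : 0 < s) (hs' : s * a ≤ 1) (hq : a ≤ q)
    (ht : 0 < t) (ht' : t ≤ c)
    (h₁ : α₁ = x + y * u₁ + z * v₁) (h₂ : α₂ = x - y * u₂ - z * q)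
    (h₃ : α₃ = x - y * s - z * t) :
    |y| * u₁ ≤ |α₁| + |α₃| + |z| * (1 + c) ∧ |z| * (q - c) ≤ |α₂| + |α₃| + |y| ∧
      |x| ≤ |α₃| + |y| * s + |z| * c := by
  have hc0 : 0 < c := by nlinarith
  have hc1 : c ≤ 1 := by nlinarith
  refine ⟨?_, ?_, ?_⟩
  -- Subtracting the third conjugate eliminates `x`.
  · have e : y * (u₁ + s) = α₁ - α₃ - z * (v₁ + t) := by rw [h₁, h₃]; ring
    calc |y| * u₁ ≤ |y| * (u₁ + s) := by gcongr; linarith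
      _ = |y * (u₁ + s)| := by rw [abs_mul, abs_of_pos (by linarith : 0 < u₁ + s)]
      _ ≤ |α₁| + |α₃| + |z * (v₁ + t)| := by
        rw [e]; exact (abs_sub _ _).trans (by gcongr; exact abs_sub _ _)
      _ ≤ |α₁| + |α₃| + |z| * (1 + c) := by
        rw [abs_mul, abs_of_pos (by linarith : 0 < v₁ + t)]; gcongr
  · have e : z * (q - t) = -(α₂ - α₃ + y * (u₂ - s)) := by rw [h₂, h₃]; ring
    have hs1 : s < 1 := by nlinarith
    calc |z| * (q - c) ≤ |z| * (q - t) := by gcongr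
      _ = |z * (q - t)| := by rw [abs_mul, abs_of_pos (by linarith : 0 < q - t)]
      _ ≤ |α₂| + |α₃| + |y * (u₂ - s)| := by
        rw [e, abs_neg]; exact (abs_add_le _ _).trans (by gcongr; exact abs_sub _ _)
      _ ≤ |α₂| + |α₃| + |y| := by
        rw [abs_mul]
        gcongr
        exact mul_le_of_le_one_right (abs_nonneg _) (abs_le.2 ⟨by linarith, by linarith⟩)
  · have e : x = α₃ + y * s + z * t := by rw [h₃]; ring
    calc |x| ≤ |α₃| + |y * s| + |z * t| := by rw [e]; exact abs_add_three _ _ _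
      _ ≤ |α₃| + |y| * s + |z| * c := by
        rw [abs_mul, abs_mul, abs_of_pos hs, abs_of_pos ht]; gcongr

/-- Bounds for the coordinates of a reduced element whose norm is at most `M ^ 2`. -/
theorem reduced_bounds {a u₁ u₂ s v₁ q t x y z α₁ α₂ α₃ c M W : ℝ} (ha : 3 ≤ a)
    (hc : c * (a - 1) = 1) (hu₁ : a ≤ u₁) (hv₁ : 0 < v₁) (hv₁' : v₁ < 1)
    (hu₂ : 0 < u₂) (hu₂' : u₂ < 1) (hs : 0 < s) (hs' : s * a ≤ 1) (hq : a ≤ q)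
    (ht : 0 < t) (ht' : t ≤ c)
    (h₁ : α₁ = x + y * u₁ + z * v₁) (h₂ : α₂ = x - y * u₂ - z * q)
    (h₃ : α₃ = x - y * s - z * t)
    (hM : M ^ 2 = 2 * a - 4) (hM0 : 0 < M) (hα₁ : M ≤ |α₁|) (hα₂ : M ≤ |α₂|)
    (hα₁' : |α₁| ≤ M * u₁) (hα₂' : |α₂| ≤ M * q) (hn : |α₁ * α₂ * α₃| ≤ M ^ 2)
    (hW : W = max |y| |z|) :
    W * (a * (a - 2)) - (a - 1) ≤ a * (a - 1) * M ∧
    a * (a - 1) * |x| ≤ a * (a - 1) + (2 * a - 1) * W ∧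
    (21 ≤ a → 1 ≤ |x| → W < 1) := by
  obtain ⟨hY, hZ, hX⟩ := coordinate_bounds ha hc (by linarith) hv₁ hv₁' hu₂ hu₂' hs hs' hq ht ht'
    h₁ h₂ h₃
  have hc0 : 0 < c := by nlinarith
  have hYW : |y| ≤ W := hW ▸ le_max_left _ _
  have hZW : |z| ≤ W := hW ▸ le_max_right _ _
  have hW0 : 0 ≤ W := (abs_nonneg y).trans hYW
  have hcase : W = |y| ∨ W = |z| := by rw [hW]; exact max_choice _ _
  rw [abs_mul, abs_mul] at hn
  have h3nn := abs_nonneg α₃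
  have hα₃ : |α₃| ≤ 1 := by
    have : M * M ≤ |α₁| * |α₂| := mul_le_mul hα₁ hα₂ hM0.le (abs_nonneg _)
    by_contra! h
    have h4 := mul_le_mul_of_nonneg_right this h3nn
    have h5 := mul_lt_mul_of_pos_left h (mul_pos hM0 hM0)
    linarith [sq M]
  have hXW : a * (a - 1) * |x| ≤ a * (a - 1) * |α₃| + (2 * a - 1) * W := by
    have e1 : |y| * s ≤ W * s := by gcongr
    have e2 : |z| * c ≤ W * c := by gcongr
    have e3 : |x| ≤ |α₃| + W * s + W * c := by linarith
    have e4 : a * (a - 1) * |x| ≤ a * (a - 1) * (|α₃| + W * s + W * c) :=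
      mul_le_mul_of_nonneg_left e3 (by nlinarith)
    have e5 : a * (a - 1) * (|α₃| + W * s + W * c)
        = a * (a - 1) * |α₃| + (a - 1) * W * (s * a) + a * W * (c * (a - 1)) := by ring
    have e6 : (a - 1) * W * (s * a) ≤ (a - 1) * W * 1 :=
      mul_le_mul_of_nonneg_left hs' (mul_nonneg (by linarith) hW0)
    rw [hc] at e5
    linarith
  have hmain : W * (a * (a - 2)) - (a - 1) ≤ a * (a - 1) * M := by
    have key : a * (W - M) ≤ 1 + W * (1 + c) := by
      rcases le_or_gt W M with h | h
      · have h4 : 0 ≤ W * (1 + c) := by positivity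
        have h5 : a * (W - M) ≤ 0 := mul_nonpos_of_nonneg_of_nonpos (by linarith) (by linarith)
        linarith
      rcases hcase with e | e
      · have h4 : |z| * (1 + c) ≤ W * (1 + c) := by gcongr
        rw [← e] at hY
        have h5 := mul_le_mul_of_nonneg_right hu₁ (sub_nonneg.2 h.le)
        linarith
      · rw [← e] at hZ
        have h5 := mul_le_mul_of_nonneg_right hq (sub_nonneg.2 h.le)
        linarith
    have e1 : (a - 1) * (a * (W - M)) ≤ (a - 1) * (1 + W * (1 + c)) :=
      mul_le_mul_of_nonneg_left key (by linarith)
    have e2 : (a - 1) * (1 + W * (1 + c)) = (a - 1) + (a - 1) * W + W * (c * (a - 1)) := by ring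
    rw [hc] at e2
    linarith
  have haa : 0 < a * (a - 1) := mul_pos (by linarith) (by linarith)
  refine ⟨hmain, by linarith [mul_le_mul_of_nonneg_left hα₃ haa.le], fun ha21 hx1 => ?_⟩
  -- Here `M ^ 2 = 2a - 4`, and `21` is the least integer `a ≥ 3` for which this holds.
  have h3M : 3 * M ≤ a - 12 / 5 := by
    by_contra! h
    have h4 := pow_lt_pow_left₀ h (by linarith) two_ne_zero
    have h5 := mul_nonneg (sub_nonneg.2 ha21) (by linarith : 0 ≤ a - 9 / 5)
    linarith
  have hWs : 3 * W ≤ a - 1 := by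
    have h4 : 0 < a * (a - 2) := mul_pos (by linarith) (by linarith)
    refine le_of_mul_le_mul_right ?_ h4
    have h5 := mul_le_mul_of_nonneg_left h3M haa.le
    have h6 : 0 ≤ (a - 1) * (a - 21) := mul_nonneg (by linarith) (by linarith)
    linarith
  -- A nonzero `x` keeps `α₃` away from `0`, so `|α₁ * α₂| ≤ 3 * M ^ 2`, and each of the two factors
  -- is at most `3 * M`.
  have hα₃' : 1 ≤ 3 * |α₃| := by
    have h4 := mul_le_mul_of_nonneg_left hWs (by linarith : 0 ≤ 2 * a - 1)
    have h5 := mul_le_mul_of_nonneg_left hx1 haa.le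
    refine le_of_mul_le_mul_left ?_ haa
    linarith
  have h12 : |α₁| * |α₂| ≤ 3 * M * M := by
    have h5 := mul_le_mul_of_nonneg_left hα₃' (mul_nonneg (abs_nonneg α₁) (abs_nonneg α₂))
    linarith [sq M]
  have h1 : |α₁| ≤ 3 * M :=
    le_of_mul_le_mul_right ((mul_le_mul_of_nonneg_left hα₂ (abs_nonneg _)).trans h12) hM0
  have h2 : |α₂| ≤ 3 * M :=
    le_of_mul_le_mul_right
      ((mul_le_mul_of_nonneg_left hα₁ (abs_nonneg _)).trans (by rwa [mul_comm])) hM0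
  have hc20 : c ≤ 1 / 20 := by
    have h4 := mul_le_mul_of_nonneg_left (by linarith : 20 ≤ a - 1) hc0.le
    linarith
  by_contra! hW1
  have hWc : W * c ≤ W * (1 / 20) := by gcongr
  have hWa : 0 ≤ (W - 1) * (a - 21) := mul_nonneg (by linarith) (by linarith)
  rcases hcase with e | e
  · have h4 : |z| * (1 + c) ≤ W * (1 + c) := by gcongr
    rw [← e] at hY
    have h5 := mul_le_mul_of_nonneg_left hu₁ hW0
    linarith
  · rw [← e] at hZ
    have h5 := mul_le_mul_of_nonneg_left hq hW0
    linarith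

/-! ### Units acting on coordinates -/

section Ring

variable {R : Type*} [CommRing R] {a : ℤ} {r : R}

theorem evalAt_mul_root (hr : r ^ 3 + (a - 1) * r ^ 2 - a * r - 1 = 0) (x y z : ℤ) :
    r * evalAt a r x y z = evalAt a r (-a * x + y + z) (x + y) (-x) := by
  simp only [evalAt]; push_cast
  linear_combination (y + z : R) * hr

theorem evalAt_mul_root_sub_one (hr : r ^ 3 + (a - 1) * r ^ 2 - a * r - 1 = 0) (x y z : ℤ) :
    (r - 1) * evalAt a r x y z = evalAt a r (-(a + 1) * x + y + z) x (-x - z) := by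
  simp only [evalAt]; push_cast
  linear_combination (y + z : R) * hr

theorem evalAt_mul_root_add (hr : r ^ 3 + (a - 1) * r ^ 2 - a * r - 1 = 0) (x y z : ℤ) :
    (r + a) * evalAt a r x y z = evalAt a r (y + z) (x + (a + 1) * y) (-x + a * z) := by
  simp only [evalAt]; push_cast
  linear_combination (y + z : R) * hr

theorem root_mul_root_sub_one_mul_root_add (hr : r ^ 3 + (a - 1) * r ^ 2 - a * r - 1 = 0) :
    r * (r - 1) * (r + a) = 1 := by
  linear_combination hr

theorem associated_of_mul_eq_one {s t w w' : R} (h : s * t = 1) (hw : s * w = w') :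
    Associated w w' :=
  ⟨⟨s, t, h, by rw [mul_comm, h]⟩, by rw [← hw, mul_comm]⟩

theorem associated_root_mul (hr : r ^ 3 + (a - 1) * r ^ 2 - a * r - 1 = 0) (x y z : ℤ) :
    Associated (evalAt a r x y z) (evalAt a r (-a * x + y + z) (x + y) (-x)) :=
  associated_of_mul_eq_one (t := (r - 1) * (r + a))
    (by linear_combination hr) (evalAt_mul_root hr x y z)

theorem associated_root_sub_one_mul (hr : r ^ 3 + (a - 1) * r ^ 2 - a * r - 1 = 0) (x y z : ℤ) :
    Associated (evalAt a r x y z) (evalAt a r (-(a + 1) * x + y + z) x (-x - z)) :=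
  associated_of_mul_eq_one (t := r * (r + a))
    (by linear_combination hr) (evalAt_mul_root_sub_one hr x y z)

theorem associated_root_add_mul (hr : r ^ 3 + (a - 1) * r ^ 2 - a * r - 1 = 0) (x y z : ℤ) :
    Associated (evalAt a r x y z) (evalAt a r (y + z) (x + (a + 1) * y) (-x + a * z)) :=
  associated_of_mul_eq_one (t := r * (r - 1))
    (by linear_combination hr) (evalAt_mul_root_add hr x y z)

theorem normForm_root_mul (x y z : ℤ) :
    normForm a (-a * x + y + z) (x + y) (-x) = normForm a x y z := by
  simp only [normForm]; ring

theorem normForm_root_sub_one_mul (x y z : ℤ) :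
    normForm a (-(a + 1) * x + y + z) x (-x - z) = normForm a x y z := by
  simp only [normForm]; ring

theorem normForm_root_add_mul (x y z : ℤ) :
    normForm a (y + z) (x + (a + 1) * y) (-x + a * z) = normForm a x y z := by
  simp only [normForm]; ring

/-- An explicit cofactor shows that the norm is a multiple. -/
theorem exists_evalAt_mul_eq_normForm (hr : r ^ 3 + (a - 1) * r ^ 2 - a * r - 1 = 0)
    (x y z : ℤ) : ∃ w : R, evalAt a r x y z * w = (normForm a x y z : ℤ) := by
  have hu : (r ^ 2 + a * r) * (r ^ 2 + a * r) =
      (a + 2) * (r ^ 2 + a * r) - (r ^ 2 + (a - 1) * r - a) + 1 := by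
    linear_combination (r + a + 1) * hr
  have huv : (r ^ 2 + a * r) * (r ^ 2 + (a - 1) * r - a) =
      (r ^ 2 + a * r) - (r ^ 2 + (a - 1) * r - a) := by
    linear_combination (r + a) * hr
  have hv : (r ^ 2 + (a - 1) * r - a) * (r ^ 2 + (a - 1) * r - a) =
      (r ^ 2 + a * r) - (a + 1) * (r ^ 2 + (a - 1) * r - a) - 1 := by
    linear_combination (r + a - 1) * hr
  rw [normForm_intCast]
  simp only [evalAt, normForm]
  generalize r ^ 2 + a * r = u at *
  generalize r ^ 2 + (a - 1) * r - a = v at *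
  -- Cofactors of the matrix of multiplication by `x + y u + z v` in the basis `1, u, v`.
  let A : R := (x + (a + 2) * y + z) * (x - y - (a + 1) * z) + (y + z) ^ 2
  let B : R := (y + z) * z - y * (x - y - (a + 1) * z)
  let C : R := -y * (y + z) - (x + (a + 2) * y + z) * z
  refine ⟨A + B * u + C * v, ?_⟩
  simp only [A, B, C]
  linear_combination y * B * hu + (y * C + z * B) * huv + z * C * hv

/-- An element whose norm is the cube of a common divisor of its coordinates is associated to that
divisor. -/
theorem associated_intCast_of_abs_normForm_eq (hr : r ^ 3 + (a - 1) * r ^ 2 - a * r - 1 = 0)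
    {x y z m : ℤ} (hx : m ∣ x) (hy : m ∣ y) (hz : m ∣ z)
    (hN : |normForm a x y z| = |m| ^ 3) : Associated (evalAt a r x y z) (m : R) := by
  obtain ⟨x, rfl⟩ := hx
  obtain ⟨y, rfl⟩ := hy
  obtain ⟨z, rfl⟩ := hz
  have e : evalAt a r (m * x) (m * y) (m * z) = m * evalAt a r x y z := by
    simp only [evalAt]; push_cast; ring
  rw [e]
  rcases eq_or_ne m 0 with rfl | hm
  · simp
  have h1 : |normForm a x y z| = 1 := by
    rw [normForm_smul, abs_mul, abs_pow] at hN
    exact mul_left_cancel₀ (pow_ne_zero 3 (abs_ne_zero.2 hm)) (by rw [hN, mul_one])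
  have hunit : IsUnit (evalAt a r x y z) := by
    obtain ⟨w, hw⟩ := exists_evalAt_mul_eq_normForm hr x y z
    refine isUnit_of_mul_isUnit_left (y := w) ?_
    rw [hw]
    exact (Int.isUnit_iff_abs_eq.2 h1).map (Int.castRingHom R)
  exact (associated_mul_unit_left _ _ hunit)

end Ring

/-! ### Real conjugates -/

section Real

variable {a : ℤ} {r₁ r₂ r₃ : ℝ}

theorem evalAt_eq_inv {r : ℝ} (hr : r ^ 3 + (a - 1) * r ^ 2 - a * r - 1 = 0) (x y z : ℤ) :
    evalAt a r x y z = x + y * (r - 1)⁻¹ + z * r⁻¹ := by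
  have h1 : (r - 1)⁻¹ = r ^ 2 + a * r :=
    inv_eq_of_mul_eq_one_right (by linear_combination hr)
  have h2 : r⁻¹ = r ^ 2 + (a - 1) * r - a :=
    inv_eq_of_mul_eq_one_right (by linear_combination hr)
  rw [h1, h2, evalAt]

/-- The two other conjugates of the root. -/
theorem exists_conjugates (ha : 3 ≤ a) :
    ∃ r₂ r₃ : ℝ, r₂ ^ 3 + (a - 1) * r₂ ^ 2 - a * r₂ - 1 = 0 ∧
      r₃ ^ 3 + (a - 1) * r₃ ^ 2 - a * r₃ - 1 = 0 ∧ r₂ ∈ Set.Ioo (-1 : ℝ) 0 ∧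
      r₃ ∈ Set.Ioo (-a : ℝ) (-a + 1) := by
  have ha' : (3 : ℝ) ≤ a := by exact_mod_cast ha
  have hcont : Continuous fun t : ℝ => t ^ 3 + (a - 1) * t ^ 2 - a * t - 1 := by fun_prop
  obtain ⟨r₂, h₂, e₂⟩ := intermediate_value_Ioo' (by norm_num : (-1 : ℝ) ≤ 0) hcont.continuousOn
    (show (0 : ℝ) ∈ _ from ⟨by norm_num, by ring_nf; linarith⟩)
  obtain ⟨r₃, h₃, e₃⟩ := intermediate_value_Ioo (by linarith : (-a : ℝ) ≤ -a + 1)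
    hcont.continuousOn (show (0 : ℝ) ∈ _ from ⟨by ring_nf; linarith, by ring_nf; nlinarith⟩)
  exact ⟨r₂, r₃, e₂, e₃, h₂, h₃⟩

theorem vieta (h₁ : r₁ ^ 3 + (a - 1) * r₁ ^ 2 - a * r₁ - 1 = 0)
    (h₂ : r₂ ^ 3 + (a - 1) * r₂ ^ 2 - a * r₂ - 1 = 0)
    (h₃ : r₃ ^ 3 + (a - 1) * r₃ ^ 2 - a * r₃ - 1 = 0)
    (h₁₂ : r₁ ≠ r₂) (h₁₃ : r₁ ≠ r₃) (h₂₃ : r₂ ≠ r₃) :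
    r₁ + r₂ + r₃ = 1 - a ∧ r₁ * r₂ + r₁ * r₃ + r₂ * r₃ = -a ∧ r₁ * r₂ * r₃ = 1 := by
  have e₁₂ : r₁ ^ 2 + r₁ * r₂ + r₂ ^ 2 + (a - 1) * (r₁ + r₂) - a = 0 :=
    mul_left_cancel₀ (sub_ne_zero.2 h₁₂) (by linear_combination h₁ - h₂)
  have e₁₃ : r₁ ^ 2 + r₁ * r₃ + r₃ ^ 2 + (a - 1) * (r₁ + r₃) - a = 0 :=
    mul_left_cancel₀ (sub_ne_zero.2 h₁₃) (by linear_combination h₁ - h₃)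
  have e : r₁ + r₂ + r₃ + (a - 1) = 0 :=
    mul_left_cancel₀ (sub_ne_zero.2 h₂₃) (by linear_combination e₁₂ - e₁₃)
  have hr₃ : r₃ = 1 - a - r₁ - r₂ := by linear_combination e
  have e2 : r₁ * r₂ + r₁ * r₃ + r₂ * r₃ = -a := by
    rw [hr₃]; linear_combination -e₁₂
  refine ⟨by linear_combination e, e2, ?_⟩
  linear_combination h₁ - r₁ ^ 2 * e + r₁ * e2

theorem evalAt_mul_evalAt_mul_evalAt (hs : r₁ + r₂ + r₃ = 1 - a)
    (hp : r₁ * r₂ + r₁ * r₃ + r₂ * r₃ = -a) (ht : r₁ * r₂ * r₃ = 1) (x y z : ℤ) :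
    evalAt a r₁ x y z * evalAt a r₂ x y z * evalAt a r₃ x y z = (normForm a x y z : ℤ) := by
  have key (p q s : ℝ) : (p + q * r₁ + s * r₁ ^ 2) * (p + q * r₂ + s * r₂ ^ 2) *
      (p + q * r₃ + s * r₃ ^ 2) =
      p ^ 3 + p ^ 2 * q * (r₁ + r₂ + r₃)
      + p ^ 2 * s * ((r₁ + r₂ + r₃) ^ 2 - 2 * (r₁ * r₂ + r₁ * r₃ + r₂ * r₃))
      + p * q ^ 2 * (r₁ * r₂ + r₁ * r₃ + r₂ * r₃)
      + p * q * s * ((r₁ + r₂ + r₃) * (r₁ * r₂ + r₁ * r₃ + r₂ * r₃) - 3 * (r₁ * r₂ * r₃))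
      + p * s ^ 2 * ((r₁ * r₂ + r₁ * r₃ + r₂ * r₃) ^ 2 - 2 * (r₁ + r₂ + r₃) * (r₁ * r₂ * r₃))
      + q ^ 3 * (r₁ * r₂ * r₃) + q ^ 2 * s * ((r₁ + r₂ + r₃) * (r₁ * r₂ * r₃))
      + q * s ^ 2 * ((r₁ * r₂ + r₁ * r₃ + r₂ * r₃) * (r₁ * r₂ * r₃))
      + s ^ 3 * (r₁ * r₂ * r₃) ^ 2 := by ring
  rw [hs, hp, ht] at key
  have e (r : ℝ) : evalAt a r x y z =
      (x - a * z) + (a * y + (a - 1) * z) * r + (y + z) * r ^ 2 := by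
    simp only [evalAt]; ring
  rw [e, e, e, key, normForm_intCast, normForm]
  ring

end Real

/-! ### Reduction by units -/

section Descent

variable {R : Type*} [CommRing R] {a : ℤ} {r : R} {r₁ r₂ : ℝ}

/-- Multiplying by powers of `r + a` makes two conjugates large. -/
theorem exists_associated_le_abs (hr : r ^ 3 + (a - 1) * r ^ 2 - a * r - 1 = 0)
    (h₁ : r₁ ^ 3 + (a - 1) * r₁ ^ 2 - a * r₁ - 1 = 0)
    (h₂ : r₂ ^ 3 + (a - 1) * r₂ ^ 2 - a * r₂ - 1 = 0)
    (hr₁ : 2 ≤ r₁ + a) (hr₂ : 2 ≤ r₂ + a) {x y z : ℤ}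
    (hx₁ : evalAt a r₁ x y z ≠ 0) (hx₂ : evalAt a r₂ x y z ≠ 0) (M : ℝ) :
    ∃ x' y' z' : ℤ, Associated (evalAt a r x y z) (evalAt a r x' y' z') ∧
      normForm a x' y' z' = normForm a x y z ∧
      M ≤ |evalAt a r₁ x' y' z'| ∧ M ≤ |evalAt a r₂ x' y' z'| := by
  have key (k : ℕ) : ∃ x' y' z' : ℤ, Associated (evalAt a r x y z) (evalAt a r x' y' z') ∧
      normForm a x' y' z' = normForm a x y z ∧
      2 ^ k * |evalAt a r₁ x y z| ≤ |evalAt a r₁ x' y' z'| ∧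
      2 ^ k * |evalAt a r₂ x y z| ≤ |evalAt a r₂ x' y' z'| := by
    induction k with
    | zero => exact ⟨x, y, z, Associated.refl _, rfl, by simp, by simp⟩
    | succ k ih =>
      obtain ⟨x', y', z', hA, hN, hM₁, hM₂⟩ := ih
      refine ⟨_, _, _, hA.trans (associated_root_add_mul hr x' y' z'),
        (normForm_root_add_mul x' y' z').trans hN, ?_, ?_⟩
      · rw [← evalAt_mul_root_add h₁, abs_mul,
          abs_of_nonneg (by linarith : 0 ≤ r₁ + a), pow_succ', mul_assoc]
        gcongr
      · rw [← evalAt_mul_root_add h₂, abs_mul,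
          abs_of_nonneg (by linarith : 0 ≤ r₂ + a), pow_succ', mul_assoc]
        gcongr
  have hlim {c : ℝ} (hc : 0 < c) : ∀ᶠ k : ℕ in Filter.atTop, M ≤ 2 ^ k * c :=
    ((tendsto_pow_atTop_atTop_of_one_lt one_lt_two).atTop_mul_const hc).eventually_ge_atTop M
  obtain ⟨k, hk₁, hk₂⟩ := ((hlim (abs_pos.2 hx₁)).and (hlim (abs_pos.2 hx₂))).exists
  obtain ⟨x', y', z', hA, hN, hM₁, hM₂⟩ := key k
  exact ⟨x', y', z', hA, hN, hk₁.trans hM₁, hk₂.trans hM₂⟩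

/-- Every element has an associate that lies in an explicit box for two of the conjugates. -/
theorem exists_associated_reduced (hr : r ^ 3 + (a - 1) * r ^ 2 - a * r - 1 = 0)
    (h₁ : r₁ ^ 3 + (a - 1) * r₁ ^ 2 - a * r₁ - 1 = 0)
    (h₂ : r₂ ^ 3 + (a - 1) * r₂ ^ 2 - a * r₂ - 1 = 0)
    (hr₁ : 1 < r₁) (hr₂ : r₂ < 0) (ha₁ : 2 ≤ r₁ + a) (ha₂ : 2 ≤ r₂ + a)
    (hu : 2 * (r₁ * -r₂) ≤ 1) (hv : 2 * ((r₁ - 1) * (1 - r₂)) ≤ 1) {x y z : ℤ}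
    (hx₁ : evalAt a r₁ x y z ≠ 0) (hx₂ : evalAt a r₂ x y z ≠ 0) {M : ℝ} (hM : 0 < M) :
    ∃ x' y' z' : ℤ, Associated (evalAt a r x y z) (evalAt a r x' y' z') ∧
      normForm a x' y' z' = normForm a x y z ∧
      M ≤ |evalAt a r₁ x' y' z'| ∧ M ≤ |evalAt a r₂ x' y' z'| ∧
      (r₁ - 1) * |evalAt a r₁ x' y' z'| < M ∧ -r₂ * |evalAt a r₂ x' y' z'| < M := by
  -- Each shrinking step at least halves `|α₁ * α₂|` by `hu` and `hv`, while both factors stay at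
  -- least `M`; hence the process stops.
  have key (k : ℕ) : ∀ x y z : ℤ, M ≤ |evalAt a r₁ x y z| → M ≤ |evalAt a r₂ x y z| →
      |evalAt a r₁ x y z| * |evalAt a r₂ x y z| < 2 ^ k * M ^ 2 →
      ∃ x' y' z' : ℤ, Associated (evalAt a r x y z) (evalAt a r x' y' z') ∧
        normForm a x' y' z' = normForm a x y z ∧
        M ≤ |evalAt a r₁ x' y' z'| ∧ M ≤ |evalAt a r₂ x' y' z'| ∧
        (r₁ - 1) * |evalAt a r₁ x' y' z'| < M ∧ -r₂ * |evalAt a r₂ x' y' z'| < M := by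
    induction k with
    | zero =>
      intro x y z hM₁ hM₂ h
      exfalso
      have : M * M ≤ |evalAt a r₁ x y z| * |evalAt a r₂ x y z| := by gcongr
      rw [pow_zero, one_mul, sq] at h
      linarith
    | succ k ih =>
      intro x y z hM₁ hM₂ h
      set P := |evalAt a r₁ x y z| * |evalAt a r₂ x y z| with hP
      have hP0 : 0 ≤ P := by positivity
      rw [pow_succ] at h
      by_cases hc₁ : M ≤ (r₁ - 1) * |evalAt a r₁ x y z|
      · have e₁ : |evalAt a r₁ (-(a + 1) * x + y + z) x (-x - z)| =
            (r₁ - 1) * |evalAt a r₁ x y z| := by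
          rw [← evalAt_mul_root_sub_one h₁, abs_mul, abs_of_pos (by linarith : 0 < r₁ - 1)]
        have e₂ : |evalAt a r₂ (-(a + 1) * x + y + z) x (-x - z)| =
            (1 - r₂) * |evalAt a r₂ x y z| := by
          rw [← evalAt_mul_root_sub_one h₂, abs_mul, abs_of_neg (by linarith : r₂ - 1 < 0),
            neg_sub]
        obtain ⟨x', y', z', hA, hN, hrest⟩ := ih (-(a + 1) * x + y + z) x (-x - z)
          (by rwa [e₁]) (by rw [e₂]; nlinarith) (by
            rw [e₁, e₂]
            have := mul_le_mul_of_nonneg_right hv hP0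
            have e : (r₁ - 1) * |evalAt a r₁ x y z| * ((1 - r₂) * |evalAt a r₂ x y z|) =
              ((r₁ - 1) * (1 - r₂)) * P := by rw [hP]; ring
            linarith)
        exact ⟨x', y', z', (associated_root_sub_one_mul hr x y z).trans hA,
          hN.trans (normForm_root_sub_one_mul x y z), hrest⟩
      by_cases hc₂ : M ≤ -r₂ * |evalAt a r₂ x y z|
      · have e₁ : |evalAt a r₁ (-a * x + y + z) (x + y) (-x)| = r₁ * |evalAt a r₁ x y z| := by
          rw [← evalAt_mul_root h₁, abs_mul, abs_of_pos (by linarith : 0 < r₁)]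
        have e₂ : |evalAt a r₂ (-a * x + y + z) (x + y) (-x)| = -r₂ * |evalAt a r₂ x y z| := by
          rw [← evalAt_mul_root h₂, abs_mul, abs_of_neg hr₂]
        obtain ⟨x', y', z', hA, hN, hrest⟩ := ih (-a * x + y + z) (x + y) (-x)
          (by rw [e₁]; nlinarith) (by rwa [e₂]) (by
            rw [e₁, e₂]
            have := mul_le_mul_of_nonneg_right hu hP0
            have e : r₁ * |evalAt a r₁ x y z| * (-r₂ * |evalAt a r₂ x y z|) =
              (r₁ * -r₂) * P := by rw [hP]; ring
            linarith)
        exact ⟨x', y', z', (associated_root_mul hr x y z).trans hA,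
          hN.trans (normForm_root_mul x y z), hrest⟩
      exact ⟨x, y, z, Associated.refl _, rfl, hM₁, hM₂, not_le.1 hc₁, not_le.1 hc₂⟩
  obtain ⟨x', y', z', hA, hN, hM₁, hM₂⟩ :=
    exists_associated_le_abs hr h₁ h₂ ha₁ ha₂ hx₁ hx₂ M
  obtain ⟨k, hk⟩ := pow_unbounded_of_one_lt
    (|evalAt a r₁ x' y' z'| * |evalAt a r₂ x' y' z'| / M ^ 2) one_lt_two
  obtain ⟨x'', y'', z'', hA', hN', hrest⟩ := key k x' y' z' hM₁ hM₂
    ((div_lt_iff₀ (by positivity)).1 hk)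
  exact ⟨x'', y'', z'', hA.trans hA', hN'.trans hN, hrest⟩

end Descent

/-- An element of nonzero norm of absolute value less than `2 * a - 3` is associated to a rational
integer. -/
theorem exists_associated_intCast {R : Type*} [CommRing R] {a : ℤ} (ha : 3 ≤ a) {r : R}
    (hr : r ^ 3 + (a - 1) * r ^ 2 - a * r - 1 = 0) {ρ : ℝ} (hρ : 1 < ρ)
    (hroot : ρ ^ 3 + (a - 1) * ρ ^ 2 - a * ρ - 1 = 0) {x y z : ℤ}
    (h0 : normForm a x y z ≠ 0) (hlt : |normForm a x y z| < 2 * a - 3) :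
    ∃ n : ℤ, Associated (evalAt a r x y z) (n : R) := by
  have ha' : (3 : ℝ) ≤ a := by exact_mod_cast ha
  obtain ⟨r₂, r₃, h₂, h₃, ⟨hr₂, hr₂'⟩, hr₃, hr₃'⟩ := exists_conjugates ha
  obtain ⟨hs, hp, ht⟩ := vieta hroot h₂ h₃ (by linarith) (by linarith) (by linarith)
  have hprod := evalAt_mul_evalAt_mul_evalAt hs hp ht
  -- The cofactor of `ρ - 1` in the unit relation is `ρ * (ρ + a) > a`.
  have hρa : (ρ - 1) * a ≤ 1 := by
    have := root_mul_root_sub_one_mul_root_add hroot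
    nlinarith [mul_pos (sub_pos.2 hρ) (sub_pos.2 hρ), mul_pos (sub_pos.2 hρ) (by linarith : 0 < ρ)]
  have hr₂a : -r₂ * a ≤ 1 := by
    have := root_mul_root_sub_one_mul_root_add h₂
    have h4 : 0 ≤ (-r₂) * (-r₂) * (a - 1 + r₂) :=
      mul_nonneg (mul_self_nonneg _) (by linarith)
    linarith
  have hρ3 : ρ ≤ 4 / 3 := by nlinarith
  have hr₂3 : -r₂ ≤ 1 / 3 := by nlinarith
  have hne : evalAt a ρ x y z ≠ 0 ∧ evalAt a r₂ x y z ≠ 0 := by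
    constructor <;> intro h <;> apply h0 <;> have := hprod x y z <;> rw [h] at this <;>
      simpa using this.symm
  set M := √(2 * a - 4 : ℝ) with hMdef
  have hM : M ^ 2 = 2 * a - 4 := Real.sq_sqrt (by linarith)
  have hM0 : 0 < M := Real.sqrt_pos.2 (by linarith)
  obtain ⟨x, y, z, hA, hN, hM₁, hM₂, hM₁', hM₂'⟩ := exists_associated_reduced hr hroot h₂ hρ hr₂'
    (by linarith) (by linarith) (by nlinarith) (by nlinarith) hne.1 hne.2 hM0
  rw [← hN] at hlt
  have hb := reduced_bounds (u₁ := (ρ - 1)⁻¹) (u₂ := (1 - r₂)⁻¹) (s := (1 - r₃)⁻¹) (v₁ := ρ⁻¹)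
    (q := (-r₂)⁻¹) (t := (-r₃)⁻¹) (x := x) (y := y) (z := z) (α₁ := evalAt a ρ x y z)
    (α₂ := evalAt a r₂ x y z) (α₃ := evalAt a r₃ x y z) (c := (a - 1 : ℝ)⁻¹)
    ha' (inv_mul_cancel₀ (by linarith))
    (by rw [← one_div, le_div_iff₀ (by linarith), mul_comm]; exact hρa)
    (by positivity) (inv_lt_one_of_one_lt₀ hρ) (inv_pos.2 (by linarith))
    (inv_lt_one_of_one_lt₀ (by linarith)) (inv_pos.2 (by linarith))
    (by rw [inv_mul_le_iff₀ (by linarith)]; linarith)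
    (by rw [← one_div, le_div_iff₀ (by linarith), mul_comm]; exact hr₂a)
    (inv_pos.2 (by linarith)) (inv_anti₀ (by linarith) (by linarith))
    (evalAt_eq_inv hroot x y z)
    (by rw [evalAt_eq_inv h₂, ← neg_sub r₂ 1, inv_neg, inv_neg]; ring)
    (by rw [evalAt_eq_inv h₃, ← neg_sub r₃ 1, inv_neg, inv_neg]; ring)
    hM hM0 hM₁ hM₂ (by rw [← div_eq_mul_inv, le_div_iff₀ (by linarith), mul_comm]; exact hM₁'.le)
    (by rw [← div_eq_mul_inv, le_div_iff₀ (by linarith), mul_comm]; exact hM₂'.le)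
    (by
      rw [hprod, hM]
      exact_mod_cast (by omega : |normForm a x y z| ≤ 2 * a - 4))
    (W := ((max |y| |z| : ℤ) : ℝ)) (by push_cast; rfl)
  obtain ⟨hb₁, hb₂, hb₃⟩ := hb
  rcases le_abs_normForm_or ha (le_max_left _ _) (le_max_right _ _) (x := x) (y := y) (z := z)
    -- Squaring turns the bound involving `√(2a - 4)` into one between integers.
    (fun hpos => by
      have hpos' : (0 : ℝ) < (max |y| |z| : ℤ) * (a * (a - 2)) - (a - 1) := by exact_mod_cast hpos
      have := pow_le_pow_left₀ hpos'.le hb₁ 2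
      rw [mul_pow, hM] at this
      exact_mod_cast this)
    (by exact_mod_cast hb₂)
    (fun h21 => by
      rcases eq_or_ne x 0 with h | h
      · exact Or.inl h
      · right
        have hW := hb₃ (by exact_mod_cast h21) (by exact_mod_cast Int.one_le_abs h)
        have hW' : max |y| |z| < 1 := by exact_mod_cast hW
        rw [max_lt_iff] at hW'
        exact ⟨Int.abs_lt_one_iff.1 hW'.1, Int.abs_lt_one_iff.1 hW'.2⟩) with h | ⟨m, hx, hy, hz, h⟩
  · omega
  · exact ⟨m, hA.trans (associated_intCast_of_abs_normForm_eq hr hx hy hz h)⟩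

/-! ### The field norm and the order `ℤ[ρ]` -/

open Polynomial in
-- A rational root would be an integer `k` with `k * (k - 1) * (k + a) = 1`, but `k * (k - 1)` is
-- even.
theorem minpoly_root {a : ℤ} {ρ : ℝ} (hroot : ρ ^ 3 + (a - 1) * ρ ^ 2 - a * ρ - 1 = 0) :
    minpoly ℚ ρ = X ^ 3 + C ((a : ℚ) - 1) * X ^ 2 - C (a : ℚ) * X - 1 := by
  have hdeg : (X ^ 3 + C ((a : ℚ) - 1) * X ^ 2 - C (a : ℚ) * X - 1).natDegree = 3 := by
    compute_degree!
  have hmonic : (X ^ 3 + C ((a : ℚ) - 1) * X ^ 2 - C (a : ℚ) * X - 1).Monic := by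
    monicity!
  symm
  refine minpoly.eq_of_irreducible_of_monic ?_ (by simpa using hroot) hmonic
  refine (hmonic.irreducible_iff_roots_eq_zero_of_degree_le_three (by omega) (by omega)).2 ?_
  refine Multiset.eq_zero_of_forall_notMem fun q hq => ?_
  have hq' : q ^ 3 + (a - 1) * q ^ 2 - a * q - 1 = 0 := by
    simpa using (mem_roots'.1 hq).2
  have hint : IsIntegral ℤ q := by
    refine ⟨X ^ 3 + C (a - 1) * X ^ 2 - C a * X - 1, by monicity!, ?_⟩
    simp only [eval₂_add, eval₂_sub, eval₂_mul, eval₂_pow, eval₂_X, eval₂_C, eval₂_one]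
    simpa using hq'
  obtain ⟨k, rfl⟩ := IsIntegrallyClosed.isIntegral_iff.1 hint
  have hk : k * (k - 1) * (k + a) = 1 := by
    have : (k : ℚ) * (k - 1) * (k + a) = 1 := by
      simp only [eq_intCast] at hq'
      linear_combination hq'
    exact_mod_cast this
  have h2 : Even (k * (k - 1) * (k + a)) := (Int.even_mul_pred_self k).mul_right _
  rw [hk] at h2
  exact absurd h2 (by decide)

theorem exists_basis_root {a : ℤ} {ρ : ℝ}
    (hroot : ρ ^ 3 + (a - 1) * ρ ^ 2 - a * ρ - 1 = 0) :
    ∃ b : Module.Basis (Fin 3) ℚ ℚ⟮ρ⟯,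
      ∀ i, b i = IntermediateField.AdjoinSimple.gen ℚ ρ ^ (i : ℕ) := by
  have hint : IsIntegral ℚ ρ := by
    rw [← minpoly.ne_zero_iff, minpoly_root hroot]
    refine Polynomial.Monic.ne_zero ?_
    monicity!
  have hdim : (IntermediateField.adjoin.powerBasis hint).dim = 3 := by
    rw [IntermediateField.adjoin.powerBasis_dim, minpoly_root hroot]
    compute_degree!
  refine ⟨(IntermediateField.adjoin.powerBasis hint).basis.reindex (finCongr hdim), fun i => ?_⟩
  simp

section RootOrder

variable {a : ℤ} {ρ : ℝ}

theorem gen_root (hroot : ρ ^ 3 + (a - 1) * ρ ^ 2 - a * ρ - 1 = 0) :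
    IntermediateField.AdjoinSimple.gen ℚ ρ ^ 3
      + (a - 1) * IntermediateField.AdjoinSimple.gen ℚ ρ ^ 2
      - a * IntermediateField.AdjoinSimple.gen ℚ ρ - 1 = 0 := by
  apply Subtype.ext
  simpa using hroot

theorem rootInOrder_root (hroot : ρ ^ 3 + (a - 1) * ρ ^ 2 - a * ρ - 1 = 0) :
    rootInOrder ρ ^ 3 + (a - 1) * rootInOrder ρ ^ 2 - a * rootInOrder ρ - 1 = 0 := by
  apply Subtype.ext
  simpa [rootInOrder] using gen_root hroot

theorem norm_evalAt (hroot : ρ ^ 3 + (a - 1) * ρ ^ 2 - a * ρ - 1 = 0) (x y z : ℤ) :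
    Algebra.norm ℚ (evalAt a (IntermediateField.AdjoinSimple.gen ℚ ρ) x y z) =
      (normForm a x y z : ℤ) := by
  obtain ⟨b, hb⟩ := exists_basis_root hroot
  have hg := gen_root hroot
  set g := IntermediateField.AdjoinSimple.gen ℚ ρ
  let p : ℚ := x - a * z
  let q : ℚ := a * y + (a - 1) * z
  let s : ℚ := y + z
  -- The element is `p + q g + s g²`, and `w` is the coefficient of `g²` in its product with `g`;
  -- column `j` of `A` holds the product with `g ^ j`.
  let w : ℚ := q + (1 - a) * s
  let A : Matrix (Fin 3) (Fin 3) ℚ :=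
    !![p, s, w; q, p + a * s, s + a * w; s, w, p + a * s + (1 - a) * w]
  have hA : Algebra.leftMulMatrix b (evalAt a g x y z) = A := by
    have key (j : Fin 3) : evalAt a g x y z * b j = ∑ i, A i j • b i := by
      fin_cases j <;>
        simp [A, p, q, s, w, hb, Fin.sum_univ_three, evalAt, Algebra.smul_def]
      · ring
      · linear_combination (y + z : ℚ⟮ρ⟯) * hg
      · linear_combination ((y + z) * g + y : ℚ⟮ρ⟯) * hg
    ext i j
    rw [Algebra.leftMulMatrix_eq_repr_mul, key, b.repr_sum_self]
  rw [Algebra.norm_eq_matrix_det b, hA, Matrix.det_fin_three, normForm_intCast]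
  simp [A, p, q, s, w, normForm]
  ring

theorem evalAt_rootInOrder (x y z : ℤ) :
    ((evalAt a (rootInOrder ρ) x y z : rootOrder ρ) : ℚ⟮ρ⟯) =
      evalAt a (IntermediateField.AdjoinSimple.gen ℚ ρ) x y z := by
  simp [evalAt, rootInOrder]

theorem norm_evalAt_rootInOrder (hroot : ρ ^ 3 + (a - 1) * ρ ^ 2 - a * ρ - 1 = 0)
    (x y z : ℤ) :
    Algebra.norm ℚ ((evalAt a (rootInOrder ρ) x y z : rootOrder ρ) : ℚ⟮ρ⟯) =
      (normForm a x y z : ℤ) := by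
  rw [evalAt_rootInOrder, norm_evalAt hroot]

theorem exists_eq_evalAt (hroot : ρ ^ 3 + (a - 1) * ρ ^ 2 - a * ρ - 1 = 0) (α : rootOrder ρ) :
    ∃ x y z : ℤ, α = evalAt a (rootInOrder ρ) x y z := by
  obtain ⟨α, hα⟩ := α
  have hg := gen_root hroot
  suffices ∃ x y z : ℤ, α = evalAt a (IntermediateField.AdjoinSimple.gen ℚ ρ) x y z by
    obtain ⟨x, y, z, h⟩ := this
    exact ⟨x, y, z, Subtype.ext (h.trans (evalAt_rootInOrder x y z).symm)⟩
  induction hα using Algebra.adjoin_induction with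
  | mem t ht =>
    rw [Set.mem_singleton_iff] at ht
    -- Because `1 / (ρ - 1) - 1 / ρ = ρ + a`.
    exact ⟨-a, 1, -1, by rw [ht, evalAt]; push_cast; ring⟩
  | algebraMap n => exact ⟨n, 0, 0, by simp [evalAt]⟩
  | add s t _ _ hs ht =>
    obtain ⟨x, y, z, rfl⟩ := hs
    obtain ⟨x', y', z', rfl⟩ := ht
    exact ⟨x + x', y + y', z + z', by simp only [evalAt]; push_cast; ring⟩
  | mul s t _ _ hs ht =>
    obtain ⟨x, y, z, rfl⟩ := hs
    obtain ⟨x', y', z', rfl⟩ := ht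
    obtain ⟨x₁, y₁, z₁, h₁⟩ : ∃ x₁ y₁ z₁ : ℤ,
        IntermediateField.AdjoinSimple.gen ℚ ρ *
          evalAt a (IntermediateField.AdjoinSimple.gen ℚ ρ) x' y' z' =
        evalAt a (IntermediateField.AdjoinSimple.gen ℚ ρ) x₁ y₁ z₁ :=
      ⟨_, _, _, evalAt_mul_root hg x' y' z'⟩
    have h₂ := evalAt_mul_root hg x₁ y₁ z₁
    set g := IntermediateField.AdjoinSimple.gen ℚ ρ
    refine ⟨(x - a * z) * x' + (a * y + (a - 1) * z) * x₁ + (y + z) * (-a * x₁ + y₁ + z₁),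
      (x - a * z) * y' + (a * y + (a - 1) * z) * y₁ + (y + z) * (x₁ + y₁),
      (x - a * z) * z' + (a * y + (a - 1) * z) * z₁ + (y + z) * (-x₁), ?_⟩
    have e : evalAt a g x y z * evalAt a g x' y' z' = (x - a * z) * evalAt a g x' y' z' +
        (a * y + (a - 1) * z) * (g * evalAt a g x' y' z') +
        (y + z) * (g * (g * evalAt a g x' y' z')) := by
      generalize evalAt a g x' y' z' = t
      simp only [evalAt]; ring
    rw [e, h₁, h₂]
    simp only [evalAt]; push_cast; ring

/-- `ρ ^ 2 - 1` is not divisible by a rational integer other than `1` and `-1`. -/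
theorem abs_eq_one_of_intCast_dvd (hroot : ρ ^ 3 + (a - 1) * ρ ^ 2 - a * ρ - 1 = 0) {n : ℤ}
    (h : (n : rootOrder ρ) ∣ -1 + rootInOrder ρ ^ 2) : |n| = 1 := by
  obtain ⟨β, hβ⟩ := h
  obtain ⟨x, y, z, rfl⟩ := exists_eq_evalAt hroot β
  obtain ⟨b, hb⟩ := exists_basis_root hroot
  have h1 : -1 + IntermediateField.AdjoinSimple.gen ℚ ρ ^ 2 =
      n * evalAt a (IntermediateField.AdjoinSimple.gen ℚ ρ) x y z := by
    have := congrArg (Subtype.val : rootOrder ρ → ℚ⟮ρ⟯) hβ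
    simp only [Subalgebra.coe_mul, evalAt_rootInOrder] at this
    simpa [rootInOrder] using this
  set g := IntermediateField.AdjoinSimple.gen ℚ ρ
  let c : Fin 3 → ℚ := ![n * (x - a * z) + 1, n * (a * y + (a - 1) * z), n * (y + z) - 1]
  have h2 : ∑ i, c i • b i = 0 := by
    simp [c, hb, Fin.sum_univ_three, Algebra.smul_def]
    simp only [evalAt] at h1
    linear_combination -h1
  -- Comparing coefficients of `g²`.
  have h3 := Fintype.linearIndependent_iff.1 b.linearIndependent c h2 2
  have h4 : n * (y + z) = 1 := by
    have : (n : ℚ) * (y + z) = 1 := by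
      simpa [c, sub_eq_zero] using h3
    exact_mod_cast this
  exact Int.isUnit_iff_abs_eq.1 (IsUnit.of_mul_eq_one _ h4)

end RootOrder

theorem proposition3 (a : ℤ) (ha : 3 ≤ a) (ρ : ℝ) (hρ : 1 < ρ)
    (hroot : ρ ^ 3 + ((a : ℝ) - 1) * ρ ^ 2 - (a : ℝ) * ρ - 1 = 0) :
    (∀ α : rootOrder ρ,
      2 * (a : ℚ) - 3 ≤ |Algebra.norm ℚ (α : ℚ⟮ρ⟯)| ∨
        ∃ n : ℤ, Associated α (n : rootOrder ρ)) ∧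
    (|Algebra.norm ℚ ((-1 + rootInOrder ρ ^ 2 : rootOrder ρ) : ℚ⟮ρ⟯)| = 2 * (a : ℚ) - 3 ∧
      ¬ ∃ n : ℤ, Associated (-1 + rootInOrder ρ ^ 2) (n : rootOrder ρ)) := by
  have hr := rootInOrder_root hroot
  have hnorm : |Algebra.norm ℚ ((-1 + rootInOrder ρ ^ 2 : rootOrder ρ) : ℚ⟮ρ⟯)| =
      2 * (a : ℚ) - 3 := by
    have e : (-1 + rootInOrder ρ ^ 2 : rootOrder ρ) =
        evalAt a (rootInOrder ρ) (a ^ 2 - 1) (1 - a) a := by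
      simp only [evalAt]; push_cast; ring
    have e2 : normForm a (a ^ 2 - 1) (1 - a) a = -(2 * a - 3) := by
      simp only [normForm]; ring
    rw [e, norm_evalAt_rootInOrder hroot, e2, ← Int.cast_abs, abs_neg, abs_of_pos (by omega)]
    push_cast; ring
  refine ⟨fun α => ?_, hnorm, ?_⟩
  · obtain ⟨x, y, z, rfl⟩ := exists_eq_evalAt hroot α
    rw [norm_evalAt_rootInOrder hroot]
    rcases le_or_gt (2 * a - 3) |normForm a x y z| with h | h
    · left; exact_mod_cast h
    right
    rcases eq_or_ne (normForm a x y z) 0 with h0 | h0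
    · refine ⟨0, ?_⟩
      have hN := norm_evalAt_rootInOrder hroot x y z
      have hfin : FiniteDimensional ℚ ℚ⟮ρ⟯ :=
        let ⟨b, _⟩ := exists_basis_root hroot
        b.finiteDimensional_of_finite
      rw [h0, Int.cast_zero, Algebra.norm_eq_zero_iff] at hN
      rw [Int.cast_zero, associated_zero_iff_eq_zero]
      exact Subtype.ext hN
    · exact exists_associated_intCast ha hr hρ hroot h0 h
  -- Such an `n` divides `ρ ^ 2 - 1`, so it is `1` or `-1`, and `ρ ^ 2 - 1` would be a unit; its
  -- norm has absolute value `2a - 3 ≥ 3`.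
  · rintro ⟨n, hn⟩
    have hn1 := abs_eq_one_of_intCast_dvd hroot hn.symm.dvd
    have hunit : IsUnit (-1 + rootInOrder ρ ^ 2 : rootOrder ρ) :=
      hn.isUnit_iff.2 ((Int.isUnit_iff_abs_eq.2 hn1).map (Int.castRingHom (rootOrder ρ)))
    obtain ⟨β, hβ⟩ := hunit.exists_right_inv
    obtain ⟨x, y, z, rfl⟩ := exists_eq_evalAt hroot β
    have h1 := congrArg (fun t : rootOrder ρ => |Algebra.norm ℚ (t : ℚ⟮ρ⟯)|) hβ
    simp only [Subalgebra.coe_mul, map_mul, abs_mul, hnorm, norm_evalAt_rootInOrder hroot,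
      Subalgebra.coe_one, map_one, abs_one] at h1
    have h2 : (2 * a - 3) * |normForm a x y z| = 1 := by exact_mod_cast h1
    have h3 := Int.eq_one_or_neg_one_of_mul_eq_one h2
    omega
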